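/- Let $n\ge 0$ and let $A,B,X,Y\in\mathcal M_n$ be complex $n\times n$ matrices with $A,B$ strictly accretive, i.e. $\Re(A)=\frac{A+A^*}{2}>O$ and $\Re(B)>O$ (positive definite). Then \[ \begin{bmatrix} A & X\\ Y^* & B\end{bmatrix}\ \text{is APT} \quad\Longleftrightarrow\quad \begin{bmatrix} A\sharp_t B & X\\ Y^* & A\sharp_{1-t} B\end{bmatrix}\ \text{is APT for all } t\in[0,1]. \] Here a square complex matrix is called accretive if its numerical range $\{\langle Mx,x\rangle:\|x\|=1\}$ lies in $\{z\in\mathbb C:\Re z\ge 0\}$; a $2\times2$ block matrix $M=\begin{bmatrix} P & Q\\ R & S\end{bmatrix}$ with blocks in $\mathcal M_n$ is called APT (accretive partial transpose) if both $M$ and its partial transpose $M^\tau=\begin{bmatrix} P & R\\ Q & S\end{bmatrix}$ are accretive; and the weighted geometric mean is \[ A\sharp_t B = A^{1/2}\bigl(A^{-1/2}BA^{-1/2}\bigr)^{t}A^{1/2},\qquad 0\le t\le 1, \] where the powers are taken in the holomorphic functional calculus for matrices with the principal branch of $z\mapsto z^s$ on $\mathbb C\setminus(-\infty,0]$ (which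 contains the spectra of $A$ and of $A^{-1/2}BA^{-1/2}$). -/

import Mathlib

open scoped Matrix ComplexOrder

/-- The polynomial `p` interpolates `f` on the spectrum of `A` in the sense of Hermite: at every
eigenvalue `z` of `A`, whose multiplicity in the minimal polynomial of `A` is `m`, the values and
the first `m - 1` derivatives of `p` and of `f` at `z` agree. -/
def InterpolatesOnSpectrum {n : Type*} [Fintype n] [DecidableEq n]
    (f : ℂ → ℂ) (A : Matrix n n ℂ) (p : Polynomial ℂ) : Prop :=
  ∀ z ∈ spectrum ℂ A, ∀ k < (minpoly ℂ A).rootMultiplicity z,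
    (Polynomial.derivative^[k] p).eval z = iteratedDeriv k f z

/-- Hermite interpolation at one node. -/
theorem exists_polynomial_jet (c : ℕ → ℂ) (z : ℂ) (m : ℕ) :
    ∃ p : Polynomial ℂ, ∀ k < m, (Polynomial.derivative^[k] p).eval z = c k := by
  induction m with
  | zero => exact ⟨0, by simp⟩
  | succ m ih =>
    obtain ⟨p, hp⟩ := ih
    refine ⟨p + Polynomial.C ((c m - (Polynomial.derivative^[m] p).eval z) / (m.factorial : ℂ)) *
      (Polynomial.X - Polynomial.C z) ^ m, fun k hk => ?_⟩
    rw [iterate_map_add, Polynomial.iterate_derivative_C_mul,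
      Polynomial.iterate_derivative_X_sub_pow]
    rcases Nat.lt_succ_iff_lt_or_eq.mp hk with h | rfl
    · have h0 : m - k ≠ 0 := by omega
      simp [hp k h, h0]
    · have h1 : (k.factorial : ℂ) ≠ 0 := by exact_mod_cast k.factorial_ne_zero
      simp [Nat.descFactorial_self]
      field_simp
      ring

/-- A multiple of `(X - z) ^ m` has vanishing derivatives of order less than `m` at `z`. -/
theorem eval_iterate_derivative_eq_zero_of_dvd {g : Polynomial ℂ} {z : ℂ} {m k : ℕ}
    (h : (Polynomial.X - Polynomial.C z) ^ m ∣ g) (hk : k < m) :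
    (Polynomial.derivative^[k] g).eval z = 0 := by
  have h1 := Polynomial.pow_sub_dvd_iterate_derivative_of_pow_dvd k h
  have h2 : (Polynomial.X - Polynomial.C z) ∣ Polynomial.derivative^[k] g :=
    (dvd_pow_self _ (by omega)).trans h1
  exact Polynomial.dvd_iff_isRoot.mp h2

/-- Hermite interpolation at finitely many nodes. -/
theorem exists_hermite_interpolant (c : ℂ → ℕ → ℂ) (m : ℂ → ℕ) (S : Finset ℂ) :
    ∃ p : Polynomial ℂ, ∀ z ∈ S, ∀ k < m z, (Polynomial.derivative^[k] p).eval z = c z k := by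
  classical
  induction S using Finset.induction_on with
  | empty => exact ⟨0, by simp⟩
  | insert w S hw ih =>
    obtain ⟨p, hp⟩ := ih
    obtain ⟨T, hT⟩ := exists_polynomial_jet (c w) w (m w)
    have hco : IsCoprime (∏ z ∈ S, (Polynomial.X - Polynomial.C z) ^ m z)
        ((Polynomial.X - Polynomial.C w) ^ m w) := by
      refine IsCoprime.prod_left fun z hz => IsCoprime.pow ?_
      exact Polynomial.isCoprime_X_sub_C_of_isUnit_sub
        (sub_ne_zero.mpr (show z ≠ w by rintro rfl; exact hw hz)).isUnit
    obtain ⟨u, v, huv⟩ := hco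
    set r := ∏ z ∈ S, (Polynomial.X - Polynomial.C z) ^ m z with hr
    refine ⟨p + u * (T - p) * r, fun z hz k hk => ?_⟩
    rcases Finset.mem_insert.mp hz with rfl | hz
    · have hd : (Polynomial.X - Polynomial.C z) ^ m z ∣ (p + u * (T - p) * r) - T :=
        ⟨v * (p - T), by linear_combination (T - p) * huv⟩
      have h0 := eval_iterate_derivative_eq_zero_of_dvd hd hk
      rw [Polynomial.iterate_derivative_sub, Polynomial.eval_sub, sub_eq_zero] at h0
      rw [h0, hT k hk]
    · have hd : (Polynomial.X - Polynomial.C z) ^ m z ∣ u * (T - p) * r :=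
        (Finset.dvd_prod_of_mem (fun z => (Polynomial.X - Polynomial.C z) ^ m z) hz).mul_left _
      rw [iterate_map_add, Polynomial.eval_add,
        eval_iterate_derivative_eq_zero_of_dvd hd hk, add_zero, hp z hz k hk]

theorem exists_interpolatesOnSpectrum {n : Type*} [Fintype n] [DecidableEq n]
    (f : ℂ → ℂ) (A : Matrix n n ℂ) : ∃ p : Polynomial ℂ, InterpolatesOnSpectrum f A p := by
  obtain ⟨p, hp⟩ := exists_hermite_interpolant (fun z k => iteratedDeriv k f z)
    (fun z => (minpoly ℂ A).rootMultiplicity z) (Matrix.finite_spectrum A).toFinset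
  exact ⟨p, fun z hz => hp z (by simpa using hz)⟩

/-- The matrix `f(A)`, for a function `f` that is holomorphic near the spectrum of `A`: the value
`p(A)` of any polynomial `p` that interpolates `f` on the spectrum of `A` (Hermite interpolation).
It coincides with the Cauchy integral of `f(z) (z - A)⁻¹` around the spectrum. -/
noncomputable def matrixFunction {n : Type*} [Fintype n] [DecidableEq n]
    (f : ℂ → ℂ) (A : Matrix n n ℂ) : Matrix n n ℂ :=
  Polynomial.aeval A (exists_interpolatesOnSpectrum f A).choose

/-- `f(A)` does not depend on the interpolating polynomial. -/
theorem matrixFunction_eq_aeval {n : Type*} [Fintype n] [DecidableEq n]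
    {f : ℂ → ℂ} {A : Matrix n n ℂ} {p : Polynomial ℂ} (hp : InterpolatesOnSpectrum f A p) :
    matrixFunction f A = Polynomial.aeval A p := by
  have hq := (exists_interpolatesOnSpectrum f A).choose_spec
  unfold matrixFunction
  set q := (exists_interpolatesOnSpectrum f A).choose
  have hint : IsIntegral ℂ A := Algebra.IsIntegral.isIntegral A
  have hne : minpoly ℂ A ≠ 0 := minpoly.ne_zero hint
  rw [← sub_eq_zero, ← map_sub]
  refine Polynomial.aeval_eq_zero_of_dvd_aeval_eq_zero (p := minpoly ℂ A) ?_ (minpoly.aeval ℂ A)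
  by_cases hqp : q - p = 0
  · simp [hqp]
  refine (IsAlgClosed.splits (minpoly ℂ A)).dvd_of_roots_le_roots hne ?_
  classical
  refine Multiset.le_iff_count.mpr fun z => ?_
  rw [Polynomial.count_roots, Polynomial.count_roots]
  by_cases hz : z ∈ spectrum ℂ A
  · by_contra! hlt
    have := (Polynomial.lt_rootMultiplicity_iff_isRoot_iterate_derivative
      (n := (q - p).rootMultiplicity z) (t := z) hqp).mpr fun k hk => by
        rw [Polynomial.IsRoot.def, Polynomial.iterate_derivative_sub, Polynomial.eval_sub,
          hq z hz k (by omega), hp z hz k (by omega), sub_self]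
    exact lt_irrefl _ this
  · have : ¬ (minpoly ℂ A).IsRoot z := by
      rw [← Matrix.minpoly_toLin', ← Module.End.hasEigenvalue_iff_isRoot,
        Module.End.hasEigenvalue_iff_mem_spectrum, Matrix.spectrum_toLin']
      exact hz
    rw [Polynomial.rootMultiplicity_eq_zero this]
    exact Nat.zero_le _

/-- The principal power `A ^ s`, i.e. `f(A)` for the principal branch of `f(z) = z ^ s`, which is
holomorphic off `(-∞, 0]`; meaningful for matrices without eigenvalues in `(-∞, 0]`. -/
noncomputable def matrixPow {n : Type*} [Fintype n] [DecidableEq n]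
    (A : Matrix n n ℂ) (s : ℝ) : Matrix n n ℂ :=
  matrixFunction (fun z : ℂ => z ^ (s : ℂ)) A

/-- The weighted geometric mean
`A ♯_t B = A ^ (1/2) (A ^ (-1/2) B A ^ (-1/2)) ^ t A ^ (1/2)`. -/
noncomputable def weightedGeomMean {n : Type*} [Fintype n] [DecidableEq n]
    (t : ℝ) (A B : Matrix n n ℂ) : Matrix n n ℂ :=
  matrixPow A (1 / 2) * matrixPow (matrixPow A (-1 / 2) * B * matrixPow A (-1 / 2)) t *
    matrixPow A (1 / 2)

/-- The numerical range `{⟨A x, x⟩ : ‖x‖ = 1}`, for the Euclidean inner product. -/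
def matrixNumericalRange {n : Type*} [Fintype n] (A : Matrix n n ℂ) : Set ℂ :=
  {w | ∃ x : n → ℂ, star x ⬝ᵥ x = 1 ∧ w = star x ⬝ᵥ (A *ᵥ x)}

/-- `A` is accretive: its numerical range lies in the closed right half-plane. -/
def IsAccretive {n : Type*} [Fintype n] (A : Matrix n n ℂ) : Prop :=
  matrixNumericalRange A ⊆ {w | 0 ≤ w.re}

/-- `A` is strictly accretive: its real part `(A + A*) / 2` is positive definite. -/
def IsStrictlyAccretive {n : Type*} [Fintype n] (A : Matrix n n ℂ) : Prop :=
  ((1 / 2 : ℂ) • (A + Aᴴ)).PosDef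

/-- The partial transpose of a `2 × 2` block matrix: the off-diagonal blocks are exchanged. -/
def partialTranspose {n : Type*} (M : Matrix (n ⊕ n) (n ⊕ n) ℂ) : Matrix (n ⊕ n) (n ⊕ n) ℂ :=
  Matrix.fromBlocks M.toBlocks₁₁ M.toBlocks₂₁ M.toBlocks₁₂ M.toBlocks₂₂

/-- `M` is APT (accretive partial transpose): `M` and its partial transpose are accretive. -/
def IsAPT {n : Type*} [Fintype n] (M : Matrix (n ⊕ n) (n ⊕ n) ℂ) : Prop :=
  IsAccretive M ∧ IsAccretive (partialTranspose M)

/-! ### Integral representation of `z ^ (t - 1)` and its derivatives on the slit plane. -/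

section Scalar

open MeasureTheory Set Filter Complex
open scoped Topology Nat

/-! Put `C = A ^ (-1/2) B A ^ (-1/2)` and `K = A ^ (-1/2) C ^ (t - 1) A ^ (-1/2)`. Then `A ♯_t B = B
K A` and `A ♯_{1-t} B = K⁻¹`. For `0 < t < 1`, `C ^ (t - 1)` is a positive multiple of `∫ s ^ (t -
1) (C + s)⁻¹ ds`, so `K` is the same multiple of `∫ s ^ (t - 1) (B + s A)⁻¹ ds`
(`exists_map_matrixPow_eq_integral`, `conj_inv_add_smul_one`).

With `y = K w`, the real part of the quadratic form of the new block matrix at `(x, y)` becomes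
real-linear in `K` (`couplingFunctional`). It therefore suffices to prove nonnegativity with `K`
replaced by `T = (B + s A)⁻¹`. There `x` splits as `T B x + s T A x` and `w` as `B T w + s A T w`,
and the form becomes a value of the form of the original matrix plus `s` times a value of the form
of its partial transpose (`parallelSum_coupling_nonneg`). This is why both accretivity hypotheses
are needed for each conclusion.

The endpoints `t = 0, 1` give the original matrix and its diagonal swap; `t = 0` alone yields the
converse. -/

theorem iteratedDeriv_eqOn_of_hasDerivAt {U : Set ℂ} (hU : IsOpen U) (G : ℕ → ℂ → ℂ)
    (h : ∀ k, ∀ z ∈ U, HasDerivAt (G k) (G (k + 1) z) z) (k : ℕ) :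
    EqOn (iteratedDeriv k (G 0)) (G k) U := by
  induction k with
  | zero => intro z _; simp
  | succ k ih =>
    intro z hz
    rw [iteratedDeriv_succ, (ih.eventuallyEq_of_mem (hU.mem_nhds hz)).deriv_eq]
    exact (h k z hz).deriv

/-- The `k`-th derivative of the function `w ↦ (w + s)⁻¹`. -/
noncomputable def resolventDeriv (k : ℕ) (s : ℝ) (w : ℂ) : ℂ :=
  (-1) ^ k * (k ! : ℂ) * ((w + s) ^ (k + 1))⁻¹

theorem add_ofReal_ne_zero_of_mem_slitPlane {z : ℂ} (hz : z ∈ slitPlane) {s : ℝ} (hs : 0 ≤ s) :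
    z + s ≠ 0 := by
  intro h
  have h1 : z = ((-s : ℝ) : ℂ) := by push_cast; exact eq_neg_of_add_eq_zero_left h
  rw [h1, ofReal_mem_slitPlane] at hz
  linarith

theorem hasDerivAt_resolventDeriv (k : ℕ) {s : ℝ} {z : ℂ} (hz : z + s ≠ 0) :
    HasDerivAt (resolventDeriv k s) (resolventDeriv (k + 1) s z) z := by
  have h1 : HasDerivAt (fun w : ℂ => (w + s) ^ (k + 1)) ((k + 1 : ℕ) * (z + s) ^ k * 1) z :=
    ((hasDerivAt_id z).add_const (s : ℂ)).fun_pow (k + 1)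
  have h2 := (h1.fun_inv (pow_ne_zero _ hz)).const_mul ((-1) ^ k * (k ! : ℂ))
  refine HasDerivAt.congr_deriv h2 ?_
  unfold resolventDeriv
  rw [Nat.factorial_succ]
  push_cast
  field_simp
  ring

theorem iteratedDeriv_inv_add (k : ℕ) {s : ℝ} (hs : 0 ≤ s) {z : ℂ} (hz : z ∈ slitPlane) :
    iteratedDeriv k (fun w : ℂ => (w + s)⁻¹) z = resolventDeriv k s z := by
  have h0 : (fun w : ℂ => (w + s)⁻¹) = resolventDeriv 0 s := by
    funext w; simp [resolventDeriv]
  rw [h0]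
  exact iteratedDeriv_eqOn_of_hasDerivAt isOpen_slitPlane (fun k => resolventDeriv k s)
    (fun k z hz => hasDerivAt_resolventDeriv k (add_ofReal_ne_zero_of_mem_slitPlane hz hs)) k hz

/-- Near a point off the negative axis, `‖w + s‖` is at least a multiple of `1 + s`. -/
theorem exists_one_add_le_mul_norm_add {z : ℂ} (hz : z ∈ slitPlane) :
    ∃ C : ℝ, 0 < C ∧ ∀ᶠ w : ℂ in 𝓝 z, ∀ s : ℝ, 0 ≤ s → 1 + s ≤ C * ‖w + s‖ := by
  obtain ⟨d, hd, hball⟩ := Metric.isOpen_iff.mp isOpen_slitPlane z hz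
  -- The leading `1` pays for `s ≤ ‖w + s‖ + (‖z‖ + d / 2)`; the quotient absorbs the remaining
  -- constant through `d / 2 ≤ ‖w + s‖`.
  refine ⟨1 + (1 + (‖z‖ + d / 2)) / (d / 2), by positivity, ?_⟩
  filter_upwards [Metric.ball_mem_nhds z (half_pos hd)] with w hw s hs
  rw [Metric.mem_ball, dist_eq_norm] at hw
  have h1 : d / 2 ≤ ‖w + s‖ := by
    by_contra! hlt
    have h2 : ((-s : ℝ) : ℂ) ∈ Metric.ball z d := by
      rw [Metric.mem_ball, dist_eq_norm]
      calc ‖((-s : ℝ) : ℂ) - z‖ = ‖(w - z) - (w + s)‖ := by congr 1; push_cast; ring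
        _ ≤ ‖w - z‖ + ‖w + s‖ := norm_sub_le _ _
        _ < d := by linarith
    have := hball h2
    rw [ofReal_mem_slitPlane] at this
    linarith
  have h2 : s ≤ ‖w + s‖ + (‖z‖ + d / 2) := by
    have : ‖(s : ℂ)‖ = s := by simp [abs_of_nonneg hs]
    have h3 : (s : ℂ) = (w + s) - (w - z) - z := by ring
    calc s = ‖(s : ℂ)‖ := this.symm
      _ ≤ ‖w + s‖ + ‖w - z‖ + ‖z‖ := by
        rw [h3]
        refine (norm_sub_le _ _).trans ?_
        rw [← h3]
        gcongr
        exact norm_sub_le _ _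
      _ ≤ _ := by linarith
  have h3 : 1 + (‖z‖ + d / 2) ≤ (1 + (‖z‖ + d / 2)) / (d / 2) * ‖w + s‖ := by
    rw [div_mul_eq_mul_div, le_div_iff₀ (half_pos hd)]
    gcongr
  linarith

theorem integrableOn_rpow_mul_inv_one_add {t : ℝ} (ht : t ∈ Ioo (0 : ℝ) 1) :
    IntegrableOn (fun s : ℝ => s ^ (t - 1) * (1 + s)⁻¹) (Ioi 0) := by
  refine (Real.integrableOn_rpowIntegrand₀₁_Ioi ht zero_le_one).congr_fun ?_ measurableSet_Ioi
  intro s hs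
  simp only [Real.rpowIntegrand₀₁_eq_pow_div ht (le_of_lt hs) zero_le_one]
  rw [mul_one, div_eq_mul_inv, add_comm]

theorem norm_resolventDeriv_le {k : ℕ} {s C : ℝ} {w : ℂ} (hC : 0 < C) (hs : 0 ≤ s)
    (h : 1 + s ≤ C * ‖w + s‖) :
    ‖resolventDeriv k s w‖ ≤ k ! * C ^ (k + 1) * (1 + s)⁻¹ := by
  have h1 : (0 : ℝ) < 1 + s := by linarith
  have h2 : 0 < ‖w + s‖ := by
    by_contra! h0
    have := mul_nonpos_of_nonneg_of_nonpos hC.le h0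
    linarith
  have h3 : (‖w + s‖ ^ (k + 1))⁻¹ ≤ C ^ (k + 1) * (1 + s)⁻¹ := by
    rw [← div_eq_mul_inv, le_div_iff₀ h1, inv_mul_le_iff₀ (by positivity), ← mul_pow]
    -- One power of decay in `s` suffices for integrability, so the same dominating function serves
    -- every `k`.
    calc 1 + s ≤ (1 + s) ^ (k + 1) := le_self_pow₀ (by linarith) (by omega)
      _ ≤ (‖w + s‖ * C) ^ (k + 1) := by
        rw [mul_comm]; exact pow_le_pow_left₀ h1.le h _
  unfold resolventDeriv
  rw [norm_mul, norm_mul, norm_pow, norm_neg, norm_one, one_pow, one_mul, norm_inv, norm_pow,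
    norm_natCast, mul_assoc]
  gcongr

theorem aestronglyMeasurable_rpow_smul_resolventDeriv (t : ℝ) (k : ℕ) {z : ℂ}
    (hz : z ∈ slitPlane) :
    AEStronglyMeasurable (fun s : ℝ => s ^ (t - 1) • resolventDeriv k s z)
      (volume.restrict (Ioi 0)) := by
  refine ContinuousOn.aestronglyMeasurable ?_ measurableSet_Ioi
  refine ContinuousOn.smul (continuousOn_id.rpow_const fun s hs => Or.inl (ne_of_gt hs)) ?_
  unfold resolventDeriv
  refine continuousOn_const.mul (ContinuousOn.inv₀ (by fun_prop) fun s hs => ?_)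
  exact pow_ne_zero _ (add_ofReal_ne_zero_of_mem_slitPlane hz (le_of_lt hs))

/-- The bound is uniform for `w` near `z`, as differentiation under the integral sign requires. -/
theorem eventually_norm_rpow_smul_resolventDeriv_le (t : ℝ) (k : ℕ) {z : ℂ}
    (hz : z ∈ slitPlane) :
    ∃ C : ℝ, ∀ᶠ w : ℂ in 𝓝 z, ∀ s : ℝ, 0 < s →
      ‖s ^ (t - 1) • resolventDeriv k s w‖ ≤ C * (s ^ (t - 1) * (1 + s)⁻¹) := by
  obtain ⟨C, hC, h⟩ := exists_one_add_le_mul_norm_add hz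
  refine ⟨k ! * C ^ (k + 1), ?_⟩
  filter_upwards [h] with w hw s hs
  have h1 := norm_resolventDeriv_le (k := k) hC hs.le (hw s hs.le)
  have h2 : 0 ≤ s ^ (t - 1) := Real.rpow_nonneg hs.le _
  rw [norm_smul, Real.norm_of_nonneg h2]
  calc _ ≤ s ^ (t - 1) * (k ! * C ^ (k + 1) * (1 + s)⁻¹) := by gcongr
    _ = _ := by ring

theorem integrableOn_rpow_smul_resolventDeriv {t : ℝ} (ht : t ∈ Ioo (0 : ℝ) 1) (k : ℕ) {z : ℂ}
    (hz : z ∈ slitPlane) :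
    IntegrableOn (fun s : ℝ => s ^ (t - 1) • resolventDeriv k s z) (Ioi 0) := by
  obtain ⟨C, hC⟩ := eventually_norm_rpow_smul_resolventDeriv_le t k hz
  refine ((integrableOn_rpow_mul_inv_one_add ht).const_mul C).mono'
    (aestronglyMeasurable_rpow_smul_resolventDeriv t k hz) ?_
  exact ae_restrict_of_forall_mem measurableSet_Ioi fun s hs => hC.self_of_nhds s hs

theorem hasDerivAt_integral_rpow_smul_resolventDeriv {t : ℝ} (ht : t ∈ Ioo (0 : ℝ) 1) (k : ℕ)
    {z : ℂ} (hz : z ∈ slitPlane) :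
    HasDerivAt (fun w => ∫ s in Ioi (0 : ℝ), s ^ (t - 1) • resolventDeriv k s w)
      (∫ s in Ioi (0 : ℝ), s ^ (t - 1) • resolventDeriv (k + 1) s z) z := by
  obtain ⟨C, hC⟩ := eventually_norm_rpow_smul_resolventDeriv_le t (k + 1) hz
  have hmem := isOpen_slitPlane.mem_nhds hz
  refine (hasDerivAt_integral_of_dominated_loc_of_deriv_le
    (F := fun w s => s ^ (t - 1) • resolventDeriv k s w)
    (F' := fun w s => s ^ (t - 1) • resolventDeriv (k + 1) s w) (inter_mem hC hmem) ?_
    (integrableOn_rpow_smul_resolventDeriv ht k hz)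
    (aestronglyMeasurable_rpow_smul_resolventDeriv t (k + 1) hz) ?_
    ((integrableOn_rpow_mul_inv_one_add ht).const_mul C) ?_).2
  · filter_upwards [hmem] with w hw
    exact aestronglyMeasurable_rpow_smul_resolventDeriv t k hw
  · exact ae_restrict_of_forall_mem measurableSet_Ioi fun s hs w hw => hw.1 s hs
  · exact ae_restrict_of_forall_mem measurableSet_Ioi fun s hs w hw =>
      (hasDerivAt_resolventDeriv k
        (add_ofReal_ne_zero_of_mem_slitPlane hw.2 (le_of_lt hs))).fun_const_smul _

/-- On the positive axis the integrand is `x⁻¹` times the one representing `x ^ t`; dividing by `x`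
lowers the exponent to `t - 1`. -/
theorem integral_rpow_smul_inv_add_ofReal {t : ℝ} (ht : t ∈ Ioo (0 : ℝ) 1) {x : ℝ} (hx : 0 < x) :
    ∫ s in Ioi (0 : ℝ), s ^ (t - 1) • resolventDeriv 0 s x =
      ((∫ s in Ioi (0 : ℝ), Real.rpowIntegrand₀₁ t s 1 : ℝ) : ℂ) *
        (x : ℂ) ^ ((t - 1 : ℝ) : ℂ) := by
  have h1 : ∀ s ∈ Ioi (0 : ℝ), s ^ (t - 1) • resolventDeriv 0 s x =
      ((x⁻¹ * Real.rpowIntegrand₀₁ t s x : ℝ) : ℂ) := by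
    intro s hs
    have hs' : (0 : ℝ) < s := hs
    rw [Real.rpowIntegrand₀₁_eq_pow_div ht hs'.le hx.le]
    have h2 : x⁻¹ * (s ^ (t - 1) * x / (s + x)) = s ^ (t - 1) * (x + s)⁻¹ := by
      rw [add_comm s x]; field_simp
    rw [h2]
    simp [resolventDeriv]
  rw [setIntegral_congr_fun measurableSet_Ioi h1, integral_complex_ofReal, integral_const_mul,
    Real.integral_rpowIntegrand₀₁_eq_rpow_mul_const ht hx.le, ← ofReal_cpow hx.le,
    Real.rpow_sub_one hx.ne']
  push_cast
  ring

/-- Identity theorem: both sides are analytic on the connected slit plane and agree on the positive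
reals, which accumulate at `1`. -/
theorem integral_rpow_smul_inv_add {t : ℝ} (ht : t ∈ Ioo (0 : ℝ) 1) :
    EqOn (fun z => ∫ s in Ioi (0 : ℝ), s ^ (t - 1) • resolventDeriv 0 s z)
      (fun z => ((∫ s in Ioi (0 : ℝ), Real.rpowIntegrand₀₁ t s 1 : ℝ) : ℂ) *
        z ^ ((t - 1 : ℝ) : ℂ)) slitPlane := by
  have hf : AnalyticOnNhd ℂ (fun z => ∫ s in Ioi (0 : ℝ), s ^ (t - 1) • resolventDeriv 0 s z)
      slitPlane := DifferentiableOn.analyticOnNhd (fun z hz =>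
        (hasDerivAt_integral_rpow_smul_resolventDeriv ht 0 hz).differentiableAt.differentiableWithinAt)
        isOpen_slitPlane
  have hg : AnalyticOnNhd ℂ (fun z => ((∫ s in Ioi (0 : ℝ), Real.rpowIntegrand₀₁ t s 1 : ℝ) : ℂ) *
        z ^ ((t - 1 : ℝ) : ℂ)) slitPlane := fun z hz =>
    analyticAt_const.mul (analyticAt_id.cpow analyticAt_const hz)
  refine hf.eqOn_of_preconnected_of_frequently_eq hg
    (starConvex_one_slitPlane.isPathConnected one_mem_slitPlane).isConnected.isPreconnected
    one_mem_slitPlane ?_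
  have h1 : Tendsto (fun x : ℝ => (x : ℂ)) (𝓝[>] 1) (𝓝[≠] 1) := by
    refine tendsto_nhdsWithin_iff.mpr ⟨?_, ?_⟩
    · exact (continuous_ofReal.tendsto' 1 1 (by simp)).mono_left nhdsWithin_le_nhds
    · filter_upwards [self_mem_nhdsWithin] with x hx
      simpa using ne_of_gt (show (1 : ℝ) < x from hx)
  refine h1.frequently (Eventually.frequently ?_)
  filter_upwards [self_mem_nhdsWithin] with x hx
  exact integral_rpow_smul_inv_add_ofReal ht (zero_lt_one.trans hx)

/-- The derivatives of `z ^ (t - 1) = c ∫ s ^ (t - 1) (z + s)⁻¹ ds`. -/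
theorem exists_iteratedDeriv_cpow_eq_integral {t : ℝ} (ht : t ∈ Ioo (0 : ℝ) 1) :
    ∃ c : ℝ, 0 < c ∧ ∀ z ∈ slitPlane, ∀ k,
      iteratedDeriv k (fun w : ℂ => w ^ ((t - 1 : ℝ) : ℂ)) z =
        c • ∫ s in Ioi (0 : ℝ), s ^ (t - 1) • resolventDeriv k s z := by
  have hpos := Real.integral_rpowIntegrand₀₁_one_pos ht
  refine ⟨(∫ s in Ioi (0 : ℝ), Real.rpowIntegrand₀₁ t s 1)⁻¹, inv_pos.mpr hpos, fun z hz k => ?_⟩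
  have h1 := iteratedDeriv_eqOn_of_hasDerivAt isOpen_slitPlane
    (fun k z => ∫ s in Ioi (0 : ℝ), s ^ (t - 1) • resolventDeriv k s z)
    (fun k z hz => hasDerivAt_integral_rpow_smul_resolventDeriv ht k hz) k hz
  simp only at h1
  rw [← h1, ((integral_rpow_smul_inv_add ht).eventuallyEq_of_mem
    (isOpen_slitPlane.mem_nhds hz)).iteratedDeriv_eq, iteratedDeriv_const_mul_field]
  rw [real_smul, ofReal_inv, inv_mul_cancel_left₀]
  exact ofReal_ne_zero.mpr hpos.ne'

end Scalar

/-! ### Multiplicativity and integral representation in the matrix functional calculus. -/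

section FunctionalCalculus

open MeasureTheory Set Complex
open scoped Topology

theorem iteratedDeriv_polynomial_eval (p : Polynomial ℂ) (k : ℕ) :
    iteratedDeriv k (fun z => p.eval z) = fun z => (Polynomial.derivative^[k] p).eval z := by
  induction k with
  | zero => simp
  | succ k ih =>
    funext z
    rw [iteratedDeriv_succ, ih, Polynomial.deriv, Function.iterate_succ_apply']

variable {n : Type*} [Fintype n] [DecidableEq n]

theorem matrixFunction_polynomial_eval (p : Polynomial ℂ) (A : Matrix n n ℂ) :
    matrixFunction (fun z => p.eval z) A = Polynomial.aeval A p :=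
  matrixFunction_eq_aeval fun z _ k _ => by rw [iteratedDeriv_polynomial_eval]

theorem matrixFunction_congr {f g : ℂ → ℂ} {A : Matrix n n ℂ}
    (h : ∀ z ∈ spectrum ℂ A, f =ᶠ[𝓝 z] g) : matrixFunction f A = matrixFunction g A := by
  obtain ⟨p, hp⟩ := exists_interpolatesOnSpectrum g A
  rw [matrixFunction_eq_aeval hp]
  exact matrixFunction_eq_aeval fun z hz k hk => by rw [hp z hz k hk, (h z hz).iteratedDeriv_eq]

theorem matrixFunction_mul {f g : ℂ → ℂ} {A : Matrix n n ℂ}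
    (hf : ∀ z ∈ spectrum ℂ A, AnalyticAt ℂ f z) (hg : ∀ z ∈ spectrum ℂ A, AnalyticAt ℂ g z) :
    matrixFunction (fun z => f z * g z) A = matrixFunction f A * matrixFunction g A := by
  obtain ⟨p, hp⟩ := exists_interpolatesOnSpectrum f A
  obtain ⟨q, hq⟩ := exists_interpolatesOnSpectrum g A
  rw [matrixFunction_eq_aeval hp, matrixFunction_eq_aeval hq, ← map_mul]
  refine matrixFunction_eq_aeval fun z hz k hk => ?_
  have hpq : (fun z => (p * q).eval z) = (fun z => p.eval z) * fun z => q.eval z := by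
    funext z; simp
  have hfg : (fun z => f z * g z) = f * g := rfl
  rw [← congrFun (iteratedDeriv_polynomial_eval (p * q) k) z, hpq, hfg,
    iteratedDeriv_mul p.differentiable.contDiff.contDiffAt q.differentiable.contDiff.contDiffAt,
    iteratedDeriv_mul (hf z hz).contDiffAt (hg z hz).contDiffAt]
  -- The Leibniz rule at order `k` involves only orders `i` and `k - i`, all below the multiplicity,
  -- where the interpolation conditions hold.
  refine Finset.sum_congr rfl fun i hi => ?_
  have hi' := Finset.mem_range.mp hi
  rw [iteratedDeriv_polynomial_eval, iteratedDeriv_polynomial_eval, ← hp z hz i (by omega),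
    ← hq z hz (k - i) (by omega)]

/-- `f(A)` is a fixed linear combination of the derivatives of `f` on the spectrum. -/
theorem exists_matrixFunction_eq_sum (A : Matrix n n ℂ) :
    ∃ E : ℂ → ℕ → Matrix n n ℂ, ∀ f, matrixFunction f A =
      ∑ z ∈ (Matrix.finite_spectrum A).toFinset,
        ∑ k ∈ Finset.range ((minpoly ℂ A).rootMultiplicity z), iteratedDeriv k f z • E z k := by
  -- The `e z k` form a dual basis of Hermite data: the `k`-th derivative at `z` is `1`, every other
  -- prescribed jet entry is `0`.
  choose e he using fun (z : ℂ) (k : ℕ) => exists_hermite_interpolant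
    (fun w j => if w = z ∧ j = k then 1 else 0)
    (fun w => (minpoly ℂ A).rootMultiplicity w) (Matrix.finite_spectrum A).toFinset
  refine ⟨fun z k => Polynomial.aeval A (e z k), fun f => ?_⟩
  rw [matrixFunction_eq_aeval (p := ∑ z ∈ (Matrix.finite_spectrum A).toFinset,
    ∑ k ∈ Finset.range ((minpoly ℂ A).rootMultiplicity z), iteratedDeriv k f z • e z k)]
  · simp only [map_sum, map_smul]
  · intro w hw j hj
    have hw' : w ∈ (Matrix.finite_spectrum A).toFinset := by simpa using hw
    simp only [Polynomial.iterate_derivative_sum, Polynomial.iterate_derivative_smul,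
      Polynomial.eval_finsetSum, Polynomial.eval_smul, he _ _ w hw' j hj]
    rw [Finset.sum_eq_single_of_mem w hw', Finset.sum_eq_single_of_mem j (by simpa using hj)]
    · simp
    · intro k _ hk
      simp [hk.symm]
    · intro z _ hz
      simp [hz.symm]

theorem matrixPow_add {A : Matrix n n ℂ} (hA : spectrum ℂ A ⊆ slitPlane) (a b : ℝ) :
    matrixPow A (a + b) = matrixPow A a * matrixPow A b := by
  unfold matrixPow
  rw [← matrixFunction_mul]
  · refine matrixFunction_congr fun z hz => ?_
    filter_upwards [isOpen_slitPlane.mem_nhds (hA hz)] with w hw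
    rw [ofReal_add, cpow_add _ _ (slitPlane_ne_zero hw)]
  · exact fun z hz => analyticAt_id.cpow analyticAt_const (hA hz)
  · exact fun z hz => analyticAt_id.cpow analyticAt_const (hA hz)

theorem matrixPow_zero (A : Matrix n n ℂ) : matrixPow A 0 = 1 := by
  simpa [matrixPow] using matrixFunction_polynomial_eval 1 A

theorem matrixPow_one (A : Matrix n n ℂ) : matrixPow A 1 = A := by
  simpa [matrixPow] using matrixFunction_polynomial_eval Polynomial.X A

theorem inv_add_smul_one_eq_matrixFunction {A : Matrix n n ℂ} (hA : spectrum ℂ A ⊆ slitPlane)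
    {s : ℝ} (hs : 0 ≤ s) :
    (A + (s : ℂ) • 1)⁻¹ = matrixFunction (fun w => (w + s)⁻¹) A := by
  have h1 : matrixFunction (fun w : ℂ => w + s) A = A + (s : ℂ) • 1 := by
    have := matrixFunction_polynomial_eval (Polynomial.X + Polynomial.C (s : ℂ)) A
    simpa only [Polynomial.eval_add, Polynomial.eval_X, Polynomial.eval_C, map_add,
      Polynomial.aeval_X, Polynomial.aeval_C, Algebra.algebraMap_eq_smul_one] using this
  have h2 : matrixFunction (fun _ : ℂ => 1) A = 1 := by
    simpa using matrixFunction_polynomial_eval 1 A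
  refine Matrix.inv_eq_right_inv ?_
  have han : ∀ z : ℂ, AnalyticAt ℂ (fun w : ℂ => w + s) z := fun z =>
    analyticAt_id.add analyticAt_const
  rw [← h1, ← matrixFunction_mul (fun z _ => han z) fun z hz =>
    (han z).fun_inv (add_ofReal_ne_zero_of_mem_slitPlane (hA hz) hs), ← h2]
  refine matrixFunction_congr fun z hz => ?_
  filter_upwards [isOpen_slitPlane.mem_nhds (hA hz)] with w hw
  exact mul_inv_cancel₀ (add_ofReal_ne_zero_of_mem_slitPlane hw hs)

/-- The power `A ^ (t - 1)` is a positive multiple of `∫ s ^ (t - 1) (A + s)⁻¹ ds`, tested against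
linear functionals. -/
theorem exists_map_matrixPow_eq_integral {t : ℝ} (ht : t ∈ Ioo (0 : ℝ) 1) {A : Matrix n n ℂ}
    (hA : spectrum ℂ A ⊆ slitPlane) :
    ∃ c : ℝ, 0 < c ∧ ∀ L : Matrix n n ℂ →ₗ[ℝ] ℝ, L (matrixPow A (t - 1)) =
      c * ∫ s in Ioi (0 : ℝ), s ^ (t - 1) * L (A + (s : ℂ) • 1)⁻¹ := by
  obtain ⟨c, hc, hint⟩ := exists_iteratedDeriv_cpow_eq_integral ht
  obtain ⟨E, hE⟩ := exists_matrixFunction_eq_sum A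
  refine ⟨c, hc, fun L => ?_⟩
  set S := (Matrix.finite_spectrum A).toFinset with hS
  have hmem : ∀ z ∈ S, z ∈ slitPlane := fun z hz => hA (by simpa [hS] using hz)
  -- These continuous real functionals reduce the matrix integral to finitely many scalar integrals,
  -- with which each `Φ z k` commutes.
  let Φ : ℂ → ℕ → ℂ →L[ℝ] ℝ := fun z k =>
    (L ∘ₗ ((LinearMap.toSpanSingleton ℂ (Matrix n n ℂ) (E z k)).restrictScalars ℝ)).toContinuousLinearMap
  have hΦ : ∀ z k w, L (w • E z k) = Φ z k w := fun z k w => rfl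
  have h1 : ∀ s ∈ Ioi (0 : ℝ), s ^ (t - 1) * L (A + (s : ℂ) • 1)⁻¹ =
      ∑ z ∈ S, ∑ k ∈ Finset.range ((minpoly ℂ A).rootMultiplicity z),
        Φ z k (s ^ (t - 1) • resolventDeriv k s z) := by
    intro s hs
    rw [inv_add_smul_one_eq_matrixFunction hA (le_of_lt hs), hE, map_sum, Finset.mul_sum]
    refine Finset.sum_congr rfl fun z hz => ?_
    rw [map_sum, Finset.mul_sum]
    refine Finset.sum_congr rfl fun k _ => ?_
    rw [iteratedDeriv_inv_add k (le_of_lt hs) (hmem z hz), hΦ, map_smul, smul_eq_mul]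
  have hi : ∀ z ∈ S, ∀ k, Integrable (fun s : ℝ => Φ z k (s ^ (t - 1) • resolventDeriv k s z))
      (volume.restrict (Ioi 0)) := fun z hz k =>
    (Φ z k).integrable_comp (integrableOn_rpow_smul_resolventDeriv ht k (hmem z hz))
  rw [setIntegral_congr_fun measurableSet_Ioi h1,
    integral_finsetSum _ fun z hz => integrable_finsetSum _ fun k _ => hi z hz k, Finset.mul_sum]
  unfold matrixPow
  rw [hE, map_sum]
  refine Finset.sum_congr rfl fun z hz => ?_
  rw [integral_finsetSum _ fun k _ => hi z hz k, Finset.mul_sum, map_sum]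
  refine Finset.sum_congr rfl fun k _ => ?_
  rw [hΦ, hint z (hmem z hz), map_smul, smul_eq_mul,
    (Φ z k).integral_comp_comm (integrableOn_rpow_smul_resolventDeriv ht k (hmem z hz))]

/-- Positivity passes from the resolvents to the power because the integral has a positive weight.
-/
theorem map_matrixPow_nonneg {t : ℝ} (ht : t ∈ Ioo (0 : ℝ) 1) {A : Matrix n n ℂ}
    (hA : spectrum ℂ A ⊆ slitPlane) (L : Matrix n n ℂ →ₗ[ℝ] ℝ)
    (hL : ∀ s : ℝ, 0 < s → 0 ≤ L (A + (s : ℂ) • 1)⁻¹) : 0 ≤ L (matrixPow A (t - 1)) := by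
  obtain ⟨c, hc, h⟩ := exists_map_matrixPow_eq_integral ht hA
  rw [h]
  exact mul_nonneg hc.le (setIntegral_nonneg measurableSet_Ioi fun s hs =>
    mul_nonneg (Real.rpow_nonneg (le_of_lt hs) _) (hL s hs))

end FunctionalCalculus

/-! ### Accretivity as a quadratic-form condition, invertibility and spectra. -/

section Accretive

open Complex

theorem partialTranspose_fromBlocks {n : Type*} (P Q R S : Matrix n n ℂ) :
    partialTranspose (Matrix.fromBlocks P Q R S) = Matrix.fromBlocks P R Q S := by
  simp [partialTranspose]

variable {n : Type*} [Fintype n]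

theorem isAccretive_iff {M : Matrix n n ℂ} :
    IsAccretive M ↔ ∀ x : n → ℂ, 0 ≤ (star x ⬝ᵥ (M *ᵥ x)).re := by
  refine ⟨fun h x => ?_, fun h w ⟨x, _, hw⟩ => hw ▸ h x⟩
  by_cases hx : x = 0
  · simp [hx]
  obtain ⟨hr, him⟩ := Complex.lt_def.mp (Matrix.dotProduct_star_self_pos_iff.mpr hx)
  rw [zero_re] at hr
  have hrx' : star x ⬝ᵥ x = ((star x ⬝ᵥ x).re : ℂ) := Complex.ext rfl him.symm
  set r := (star x ⬝ᵥ x).re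
  have hs : (Real.sqrt r)⁻¹ * (Real.sqrt r)⁻¹ = r⁻¹ := by
    rw [← mul_inv, Real.mul_self_sqrt hr.le]
  have hy : ∀ N : Matrix n n ℂ, star (((Real.sqrt r)⁻¹ : ℝ) • x) ⬝ᵥ
      (N *ᵥ (((Real.sqrt r)⁻¹ : ℝ) • x)) = (r⁻¹ : ℝ) • (star x ⬝ᵥ (N *ᵥ x)) := by
    intro N
    rw [star_smul, Matrix.mulVec_smul, smul_dotProduct, dotProduct_smul, smul_smul, star_trivial,
      hs]
  -- The numerical range sees unit vectors only, so `x` is normalized by `√r = ‖x‖`.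
  have h1 := h ⟨((Real.sqrt r)⁻¹ : ℝ) • x, by
    classical
    have := hy 1
    rw [Matrix.one_mulVec, Matrix.one_mulVec, hrx'] at this
    rw [this, real_smul, ← ofReal_mul, inv_mul_cancel₀ hr.ne', ofReal_one], rfl⟩
  rw [Set.mem_ofPred_eq, hy, smul_re, smul_eq_mul] at h1
  exact nonneg_of_mul_nonneg_right h1 (inv_pos.mpr hr)

theorem IsStrictlyAccretive.re_dotProduct_mulVec_pos {A : Matrix n n ℂ}
    (hA : IsStrictlyAccretive A) {x : n → ℂ} (hx : x ≠ 0) : 0 < (star x ⬝ᵥ (A *ᵥ x)).re := by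
  have h1 := (Complex.lt_def.mp (hA.dotProduct_mulVec_pos hx)).1
  have h2 : star x ⬝ᵥ (Aᴴ *ᵥ x) = star (star x ⬝ᵥ (A *ᵥ x)) := by
    rw [Matrix.star_dotProduct, Matrix.star_mulVec, Matrix.conjTranspose_conjTranspose,
      ← Matrix.dotProduct_mulVec]
  rw [Matrix.smul_mulVec, dotProduct_smul, Matrix.add_mulVec, dotProduct_add, h2] at h1
  simp only [smul_eq_mul, star_def, add_conj] at h1
  have h3 : (1 / 2 : ℂ) * ((2 * (star x ⬝ᵥ (A *ᵥ x)).re : ℝ) : ℂ) =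
      ((star x ⬝ᵥ (A *ᵥ x)).re : ℂ) := by push_cast; ring
  rwa [h3, ofReal_re, zero_re] at h1

theorem isUnit_of_re_dotProduct_mulVec_pos [DecidableEq n] {A : Matrix n n ℂ}
    (h : ∀ x : n → ℂ, x ≠ 0 → 0 < (star x ⬝ᵥ (A *ᵥ x)).re) : IsUnit A := by
  rw [← Matrix.mulVec_injective_iff_isUnit]
  refine (injective_iff_map_eq_zero A.mulVecLin).mpr fun x hx => ?_
  by_contra hne
  have h1 := h x hne
  rw [← Matrix.mulVecLin_apply, hx] at h1
  simp at h1

theorem IsStrictlyAccretive.isUnit_add_smul [DecidableEq n] {A B : Matrix n n ℂ}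
    (hA : IsStrictlyAccretive A) (hB : IsStrictlyAccretive B) {s : ℝ} (hs : 0 ≤ s) :
    IsUnit (B + (s : ℂ) • A) := by
  refine isUnit_of_re_dotProduct_mulVec_pos fun x hx => ?_
  rw [Matrix.add_mulVec, Matrix.smul_mulVec, dotProduct_add, dotProduct_smul, smul_eq_mul, add_re,
    re_ofReal_mul]
  have := mul_nonneg hs (hA.re_dotProduct_mulVec_pos hx).le
  linarith [hB.re_dotProduct_mulVec_pos hx]

/-- A spectral point outside the slit plane is `-s` with `s ≥ 0`, which would make `A + s` singular.
-/
theorem spectrum_subset_slitPlane_of_isUnit_add_smul_one [DecidableEq n] {A : Matrix n n ℂ}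
    (h : ∀ s : ℝ, 0 ≤ s → IsUnit (A + (s : ℂ) • 1)) : spectrum ℂ A ⊆ slitPlane := by
  intro z hz
  rw [mem_slitPlane_iff_not_le_zero]
  intro hle
  obtain ⟨hre, him⟩ := Complex.le_def.mp hle
  obtain ⟨s, hs, rfl⟩ : ∃ s : ℝ, 0 ≤ s ∧ z = -(s : ℂ) :=
    ⟨-z.re, neg_nonneg.mpr hre, Complex.ext (by simp) (by simpa using him)⟩
  refine hz ?_
  have h1 : algebraMap ℂ (Matrix n n ℂ) (-(s : ℂ)) - A = -(A + (s : ℂ) • 1) := by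
    rw [Algebra.algebraMap_eq_smul_one, neg_smul]
    abel
  rw [spectrum.mem_resolventSet_iff, h1]
  exact (h s hs).neg

theorem IsStrictlyAccretive.spectrum_subset_slitPlane [DecidableEq n] {A : Matrix n n ℂ}
    (hA : IsStrictlyAccretive A) : spectrum ℂ A ⊆ slitPlane := by
  refine spectrum_subset_slitPlane_of_isUnit_add_smul_one fun s hs => ?_
  refine isUnit_of_re_dotProduct_mulVec_pos fun x hx => ?_
  rw [Matrix.add_mulVec, Matrix.smul_mulVec, dotProduct_add, dotProduct_smul, smul_eq_mul, add_re,
    re_ofReal_mul, Matrix.one_mulVec]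
  have h0 : 0 ≤ (star x ⬝ᵥ x).re := (Complex.le_def.mp (dotProduct_star_self_nonneg x)).1
  have := mul_nonneg hs h0
  linarith [hA.re_dotProduct_mulVec_pos hx]

theorem isAccretive_fromBlocks_iff {P Q R S : Matrix n n ℂ} :
    IsAccretive (Matrix.fromBlocks P Q R S) ↔ ∀ u v : n → ℂ,
      0 ≤ (star u ⬝ᵥ (P *ᵥ u)).re + (star v ⬝ᵥ (S *ᵥ v)).re +
        ((star u ⬝ᵥ (Q *ᵥ v)).re + (star v ⬝ᵥ (R *ᵥ u)).re) := by
  have key : ∀ u v : n → ℂ, (star (Sum.elim u v) ⬝ᵥ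
      (Matrix.fromBlocks P Q R S *ᵥ Sum.elim u v)).re =
      (star u ⬝ᵥ (P *ᵥ u)).re + (star v ⬝ᵥ (S *ᵥ v)).re +
        ((star u ⬝ᵥ (Q *ᵥ v)).re + (star v ⬝ᵥ (R *ᵥ u)).re) := by
    intro u v
    have hst : star (Sum.elim u v) = Sum.elim (star u) (star v) := by
      funext i; cases i <;> rfl
    rw [Matrix.fromBlocks_mulVec, hst, sumElim_dotProduct_sumElim, Sum.elim_comp_inl,
      Sum.elim_comp_inr, dotProduct_add, dotProduct_add]
    simp only [add_re]
    ring
  rw [isAccretive_iff]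
  refine ⟨fun h u v => key u v ▸ h _, fun h x => ?_⟩
  have := h (x ∘ Sum.inl) (x ∘ Sum.inr)
  rwa [← key, Sum.elim_comp_inl_inr] at this

/-- Exchanging `u` and `v` turns each accretivity condition of one matrix into the other condition
of its swap. -/
theorem IsAPT.swap {P Q R S : Matrix n n ℂ} (h : IsAPT (Matrix.fromBlocks P Q R S)) :
    IsAPT (Matrix.fromBlocks S Q R P) := by
  obtain ⟨h1, h2⟩ := h
  rw [partialTranspose_fromBlocks] at h2
  rw [isAccretive_fromBlocks_iff] at h1 h2
  refine ⟨isAccretive_fromBlocks_iff.mpr fun u v => ?_, ?_⟩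
  · linarith [h2 v u]
  · rw [partialTranspose_fromBlocks]
    exact isAccretive_fromBlocks_iff.mpr fun u v => by linarith [h1 v u]

end Accretive

/-! ### Factorizations of the geometric means and the block inequality. -/

section GeometricMean

open Complex

variable {n : Type*} [Fintype n] [DecidableEq n]

theorem matrixPow_half_mul_self {A : Matrix n n ℂ} (hA : spectrum ℂ A ⊆ slitPlane) :
    matrixPow A (1 / 2) * matrixPow A (1 / 2) = A := by
  rw [← matrixPow_add hA, add_halves, matrixPow_one]

theorem matrixPow_half_mul_neg_half {A : Matrix n n ℂ} (hA : spectrum ℂ A ⊆ slitPlane) :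
    matrixPow A (1 / 2) * matrixPow A (-1 / 2) = 1 := by
  rw [← matrixPow_add hA, ← matrixPow_zero A]
  norm_num

theorem matrixPow_neg_half_mul_half {A : Matrix n n ℂ} (hA : spectrum ℂ A ⊆ slitPlane) :
    matrixPow A (-1 / 2) * matrixPow A (1 / 2) = 1 :=
  mul_eq_one_comm.mp (matrixPow_half_mul_neg_half hA)

theorem weightedGeomMean_zero {A : Matrix n n ℂ} (hA : spectrum ℂ A ⊆ slitPlane)
    (B : Matrix n n ℂ) : weightedGeomMean 0 A B = A := by
  rw [weightedGeomMean, matrixPow_zero, mul_one, matrixPow_half_mul_self hA]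

theorem weightedGeomMean_one {A : Matrix n n ℂ} (hA : spectrum ℂ A ⊆ slitPlane)
    (B : Matrix n n ℂ) : weightedGeomMean 1 A B = B := by
  rw [weightedGeomMean, matrixPow_one]
  calc _ = (matrixPow A (1 / 2) * matrixPow A (-1 / 2)) * B *
        (matrixPow A (-1 / 2) * matrixPow A (1 / 2)) := by noncomm_ring
    _ = B := by rw [matrixPow_half_mul_neg_half hA, matrixPow_neg_half_mul_half hA, one_mul, mul_one]

/-- `A ^ (1/2) (A ^ (-1/2) B A ^ (-1/2) + s) A ^ (1/2) = B + s A`. -/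
theorem matrixPow_half_mul_add_smul_one_mul {A : Matrix n n ℂ} (hA : spectrum ℂ A ⊆ slitPlane)
    (B : Matrix n n ℂ) (s : ℂ) :
    matrixPow A (1 / 2) * (matrixPow A (-1 / 2) * B * matrixPow A (-1 / 2) + s • 1) *
      matrixPow A (1 / 2) = B + s • A := by
  calc _ = (matrixPow A (1 / 2) * matrixPow A (-1 / 2)) * B *
        (matrixPow A (-1 / 2) * matrixPow A (1 / 2)) +
          s • (matrixPow A (1 / 2) * matrixPow A (1 / 2)) := by
        rw [mul_add, add_mul, mul_smul_comm, smul_mul_assoc, mul_one]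
        noncomm_ring
    _ = _ := by
      rw [matrixPow_half_mul_neg_half hA, matrixPow_neg_half_mul_half hA,
        matrixPow_half_mul_self hA, one_mul, mul_one]

theorem add_smul_one_eq {A : Matrix n n ℂ} (hA : spectrum ℂ A ⊆ slitPlane)
    (B : Matrix n n ℂ) (s : ℂ) :
    matrixPow A (-1 / 2) * B * matrixPow A (-1 / 2) + s • 1 =
      matrixPow A (-1 / 2) * (B + s • A) * matrixPow A (-1 / 2) := by
  rw [← matrixPow_half_mul_add_smul_one_mul hA B s]
  set T := matrixPow A (-1 / 2) * B * matrixPow A (-1 / 2) + s • 1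
  calc T = 1 * T * 1 := by rw [one_mul, mul_one]
    _ = (matrixPow A (-1 / 2) * matrixPow A (1 / 2)) * T *
        (matrixPow A (1 / 2) * matrixPow A (-1 / 2)) := by
      rw [matrixPow_half_mul_neg_half hA, matrixPow_neg_half_mul_half hA]
    _ = _ := by noncomm_ring

theorem isUnit_matrixPow_neg_half {A : Matrix n n ℂ} (hA : spectrum ℂ A ⊆ slitPlane) :
    IsUnit (matrixPow A (-1 / 2)) :=
  IsUnit.of_mul_eq_one _ (matrixPow_neg_half_mul_half hA)

theorem spectrum_conj_subset_slitPlane {A B : Matrix n n ℂ} (hA : IsStrictlyAccretive A)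
    (hB : IsStrictlyAccretive B) :
    spectrum ℂ (matrixPow A (-1 / 2) * B * matrixPow A (-1 / 2)) ⊆ slitPlane := by
  have hsp := hA.spectrum_subset_slitPlane
  refine spectrum_subset_slitPlane_of_isUnit_add_smul_one fun s hs => ?_
  rw [add_smul_one_eq hsp]
  exact ((isUnit_matrixPow_neg_half hsp).mul (hA.isUnit_add_smul hB hs)).mul
    (isUnit_matrixPow_neg_half hsp)

/-- This replaces the resolvent of the conjugated matrix, which has no evident positivity, by the
inverse of a combination of `A` and `B`. -/
theorem conj_inv_add_smul_one {A B : Matrix n n ℂ} (hA : IsStrictlyAccretive A)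
    (hB : IsStrictlyAccretive B) {s : ℝ} (hs : 0 ≤ s) :
    matrixPow A (-1 / 2) * (matrixPow A (-1 / 2) * B * matrixPow A (-1 / 2) + (s : ℂ) • 1)⁻¹ *
      matrixPow A (-1 / 2) = (B + (s : ℂ) • A)⁻¹ := by
  have hsp := hA.spectrum_subset_slitPlane
  have hu : IsUnit (matrixPow A (-1 / 2) * B * matrixPow A (-1 / 2) + (s : ℂ) • 1) := by
    rw [add_smul_one_eq hsp]
    exact ((isUnit_matrixPow_neg_half hsp).mul (hA.isUnit_add_smul hB hs)).mul
      (isUnit_matrixPow_neg_half hsp)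
  rw [← matrixPow_half_mul_add_smul_one_mul hsp B s]
  set T := matrixPow A (-1 / 2) * B * matrixPow A (-1 / 2) + (s : ℂ) • 1
  symm
  refine Matrix.inv_eq_right_inv ?_
  calc _ = matrixPow A (1 / 2) * (T * ((matrixPow A (1 / 2) * matrixPow A (-1 / 2)) * T⁻¹)) *
        matrixPow A (-1 / 2) := by noncomm_ring
    _ = 1 := by
      rw [matrixPow_half_mul_neg_half hsp, one_mul,
        Matrix.mul_nonsing_inv _ ((Matrix.isUnit_iff_isUnit_det _).mp hu), mul_one,
        matrixPow_half_mul_neg_half hsp]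

/-- `A ♯_t B = B K A` with `K = A ^ (-1/2) (A ^ (-1/2) B A ^ (-1/2)) ^ (t - 1) A ^ (-1/2)`. -/
theorem weightedGeomMean_eq_mul_mul {A B : Matrix n n ℂ} (hA : IsStrictlyAccretive A)
    (hB : IsStrictlyAccretive B) (t : ℝ) :
    weightedGeomMean t A B = B * (matrixPow A (-1 / 2) *
      matrixPow (matrixPow A (-1 / 2) * B * matrixPow A (-1 / 2)) (t - 1) *
        matrixPow A (-1 / 2)) * A := by
  have hsp := hA.spectrum_subset_slitPlane
  have h1 := matrixPow_add (spectrum_conj_subset_slitPlane hA hB) 1 (t - 1)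
  rw [add_sub_cancel, matrixPow_one] at h1
  rw [weightedGeomMean, h1]
  set D := matrixPow (matrixPow A (-1 / 2) * B * matrixPow A (-1 / 2)) (t - 1)
  calc _ = (matrixPow A (1 / 2) * matrixPow A (-1 / 2)) * B * matrixPow A (-1 / 2) * D *
        matrixPow A (1 / 2) := by noncomm_ring
    _ = B * (matrixPow A (-1 / 2) * D) * ((matrixPow A (-1 / 2) * matrixPow A (1 / 2)) *
        matrixPow A (1 / 2)) := by
      rw [matrixPow_half_mul_neg_half hsp, matrixPow_neg_half_mul_half hsp]
      noncomm_ring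
    _ = B * (matrixPow A (-1 / 2) * D * matrixPow A (-1 / 2)) *
        (matrixPow A (1 / 2) * matrixPow A (1 / 2)) := by noncomm_ring
    _ = _ := by rw [matrixPow_half_mul_self hsp]

/-- `A ♯_{1-t} B` is the inverse of `A ^ (-1/2) (A ^ (-1/2) B A ^ (-1/2)) ^ (t - 1) A ^ (-1/2)`. -/
theorem mul_weightedGeomMean_one_sub {A B : Matrix n n ℂ} (hA : IsStrictlyAccretive A)
    (hB : IsStrictlyAccretive B) (t : ℝ) :
    matrixPow A (-1 / 2) * matrixPow (matrixPow A (-1 / 2) * B * matrixPow A (-1 / 2)) (t - 1) *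
        matrixPow A (-1 / 2) * weightedGeomMean (1 - t) A B = 1 := by
  have hsp := hA.spectrum_subset_slitPlane
  have h1 := matrixPow_add (spectrum_conj_subset_slitPlane hA hB) (t - 1) (1 - t)
  rw [sub_add_sub_cancel, sub_self, matrixPow_zero] at h1
  rw [weightedGeomMean]
  set C := matrixPow A (-1 / 2) * B * matrixPow A (-1 / 2)
  calc _ = matrixPow A (-1 / 2) * (matrixPow C (t - 1) *
        ((matrixPow A (-1 / 2) * matrixPow A (1 / 2)) * matrixPow C (1 - t))) *
          matrixPow A (1 / 2) := by noncomm_ring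
    _ = 1 := by
      rw [matrixPow_neg_half_mul_half hsp, one_mul, ← h1, mul_one, matrixPow_neg_half_mul_half hsp]

/-- The weighted parallel sum `B (B + s A)⁻¹ A` and `B + s A` bound a coupling that is bounded by
`A`, `B` in both orders. -/
theorem parallelSum_coupling_nonneg {A B Q R : Matrix n n ℂ}
    (h1 : IsAccretive (Matrix.fromBlocks A Q R B)) (h2 : IsAccretive (Matrix.fromBlocks A R Q B))
    {s : ℝ} (hs : 0 ≤ s) (hu : IsUnit (B + (s : ℂ) • A)) (x w : n → ℂ) :
    0 ≤ (star x ⬝ᵥ ((B * (B + (s : ℂ) • A)⁻¹ * A) *ᵥ x)).re +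
      (star ((B + (s : ℂ) • A)⁻¹ *ᵥ w) ⬝ᵥ w).re +
        ((star x ⬝ᵥ (Q *ᵥ ((B + (s : ℂ) • A)⁻¹ *ᵥ w))).re +
          (star ((B + (s : ℂ) • A)⁻¹ *ᵥ w) ⬝ᵥ (R *ᵥ x)).re) := by
  rw [isAccretive_fromBlocks_iff] at h1 h2
  have hdet := (Matrix.isUnit_iff_isUnit_det _).mp hu
  have hTT := Matrix.mul_nonsing_inv _ hdet
  have hTT' := Matrix.nonsing_inv_mul _ hdet
  set T := (B + (s : ℂ) • A)⁻¹
  set p := T *ᵥ w with hp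
  set u := (T * B) *ᵥ x with hu_def
  set v := (T * A) *ᵥ x with hv_def
  set h := (B * T * A) *ᵥ x with hh
  have e1 : T * B + (s : ℂ) • (T * A) = 1 := by rw [← hTT', mul_add, mul_smul_comm]
  have e2 : B * T + (s : ℂ) • (A * T) = 1 := by rw [← hTT, add_mul, smul_mul_assoc]
  have hx : u + (s : ℂ) • v = x := by
    rw [hu_def, hv_def, ← Matrix.smul_mulVec, ← Matrix.add_mulVec, e1, Matrix.one_mulVec]
  -- This is `A T B = B T A`: by `e1` and `e2` both `A T B` and `B T A` equal `A - s A T A`.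
  have hAu : A *ᵥ u = h := by
    rw [hu_def, hh, Matrix.mulVec_mulVec]
    congr 1
    have e3 : T * B = 1 - (s : ℂ) • (T * A) := eq_sub_of_add_eq e1
    have e4 : B * T = 1 - (s : ℂ) • (A * T) := eq_sub_of_add_eq e2
    rw [e3, e4, mul_sub, sub_mul, mul_smul_comm, smul_mul_assoc, mul_one, one_mul, mul_assoc]
  have hBv : B *ᵥ v = h := by
    rw [hv_def, hh, Matrix.mulVec_mulVec, mul_assoc]
  have hw : B *ᵥ p + (s : ℂ) • (A *ᵥ p) = w := by
    rw [← Matrix.smul_mulVec, ← Matrix.add_mulVec, hp, Matrix.mulVec_mulVec, hTT,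
      Matrix.one_mulVec]
  -- The first form is taken at `(u, p)`; the transposed one at `(p, v)`, with `p` in the first
  -- slot, so that `A p` and `B p` recombine into `w`.
  have i1 := h1 u p
  have i2 := mul_nonneg hs (h2 p v)
  rw [hAu] at i1
  rw [hBv] at i2
  have f1 : (star x ⬝ᵥ h).re = (star u ⬝ᵥ h).re + s * (star v ⬝ᵥ h).re := by
    rw [← hx]; simp [add_dotProduct, smul_dotProduct]
  have f2 : (star p ⬝ᵥ w).re = (star p ⬝ᵥ (B *ᵥ p)).re + s * (star p ⬝ᵥ (A *ᵥ p)).re := by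
    rw [← hw]; simp [dotProduct_add, dotProduct_smul]
  have f3 : (star x ⬝ᵥ (Q *ᵥ p)).re = (star u ⬝ᵥ (Q *ᵥ p)).re + s * (star v ⬝ᵥ (Q *ᵥ p)).re := by
    rw [← hx]; simp [add_dotProduct, smul_dotProduct]
  have f4 : (star p ⬝ᵥ (R *ᵥ x)).re = (star p ⬝ᵥ (R *ᵥ u)).re + s * (star p ⬝ᵥ (R *ᵥ v)).re := by
    rw [← hx]; simp [Matrix.mulVec_add, Matrix.mulVec_smul, dotProduct_add, dotProduct_smul]
  rw [f1, f2, f3, f4]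
  linarith

/-- The functional `K ↦ Re (⟨B K A x, x⟩ + ⟨w, K w⟩ + ⟨Q K w, x⟩ + ⟨R x, K w⟩)`. -/
noncomputable def couplingFunctional (A B Q R : Matrix n n ℂ) (x w : n → ℂ) :
    Matrix n n ℂ →ₗ[ℝ] ℝ where
  toFun K := (star x ⬝ᵥ ((B * K * A) *ᵥ x)).re + (star (K *ᵥ w) ⬝ᵥ w).re +
    ((star x ⬝ᵥ (Q *ᵥ (K *ᵥ w))).re + (star (K *ᵥ w) ⬝ᵥ (R *ᵥ x)).re)
  map_add' K K' := by
    simp only [mul_add, add_mul, Matrix.add_mulVec, Matrix.mulVec_add, dotProduct_add,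
      add_dotProduct, star_add, add_re]
    ring
  map_smul' c K := by
    simp only [mul_smul_comm, smul_mul_assoc, Matrix.smul_mulVec, Matrix.mulVec_smul,
      dotProduct_smul, smul_dotProduct, star_smul, smul_re, star_trivial, smul_eq_mul,
      RingHom.id_apply]
    ring

theorem isAccretive_fromBlocks_weightedGeomMean {A B Q R : Matrix n n ℂ}
    (hA : IsStrictlyAccretive A) (hB : IsStrictlyAccretive B)
    (h1 : IsAccretive (Matrix.fromBlocks A Q R B)) (h2 : IsAccretive (Matrix.fromBlocks A R Q B))
    {t : ℝ} (ht : t ∈ Set.Ioo (0 : ℝ) 1) :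
    IsAccretive (Matrix.fromBlocks (weightedGeomMean t A B) Q R (weightedGeomMean (1 - t) A B)) := by
  rw [isAccretive_fromBlocks_iff]
  intro x y
  -- Since the mean here is `K⁻¹`, this gives `y = K w` and removes the inverse of `K` from the
  -- form.
  set w := weightedGeomMean (1 - t) A B *ᵥ y with hw
  have hy : (matrixPow A (-1 / 2) *
      matrixPow (matrixPow A (-1 / 2) * B * matrixPow A (-1 / 2)) (t - 1) *
        matrixPow A (-1 / 2)) *ᵥ w = y := by
    rw [hw, Matrix.mulVec_mulVec, mul_weightedGeomMean_one_sub hA hB, Matrix.one_mulVec]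
  -- Composing with conjugation by `A ^ (-1/2)` makes the functional act on `C ^ (t - 1)` as the
  -- coupling functional acts on `K`.
  have key := map_matrixPow_nonneg ht (spectrum_conj_subset_slitPlane hA hB)
    (couplingFunctional A B Q R x w ∘ₗ LinearMap.mulLeftRight ℝ
      (matrixPow A (-1 / 2), matrixPow A (-1 / 2))) fun s hs => by
    rw [LinearMap.comp_apply, LinearMap.mulLeftRight_apply, conj_inv_add_smul_one hA hB hs.le]
    exact parallelSum_coupling_nonneg h1 h2 hs.le (hA.isUnit_add_smul hB hs.le) x w
  rw [LinearMap.comp_apply, LinearMap.mulLeftRight_apply] at key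
  simp only [couplingFunctional, LinearMap.coe_mk, AddHom.coe_mk] at key
  rwa [hy, ← weightedGeomMean_eq_mul_mul hA hB] at key

end GeometricMean

theorem mainTheorem3 {n : Type*} [Fintype n] [DecidableEq n] (A B X Y : Matrix n n ℂ)
    (hA : IsStrictlyAccretive A) (hB : IsStrictlyAccretive B) :
    IsAPT (Matrix.fromBlocks A X Yᴴ B) ↔
      ∀ t ∈ Set.Icc (0 : ℝ) 1,
        IsAPT (Matrix.fromBlocks (weightedGeomMean t A B) X Yᴴ (weightedGeomMean (1 - t) A B)) := by
  have hsp := hA.spectrum_subset_slitPlane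
  refine ⟨fun h t ht => ?_, fun h => ?_⟩
  · rcases ht.1.eq_or_lt with rfl | h0
    · rwa [sub_zero, weightedGeomMean_zero hsp, weightedGeomMean_one hsp]
    rcases ht.2.eq_or_lt with rfl | h1
    · rw [sub_self, weightedGeomMean_zero hsp, weightedGeomMean_one hsp]
      exact h.swap
    have hp := h.2
    rw [partialTranspose_fromBlocks] at hp
    refine ⟨isAccretive_fromBlocks_weightedGeomMean hA hB h.1 hp ⟨h0, h1⟩, ?_⟩
    rw [partialTranspose_fromBlocks]
    -- The pair of hypotheses is symmetric in the off-diagonal blocks, so exchanging them handles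
    -- the partial transpose.
    exact isAccretive_fromBlocks_weightedGeomMean hA hB hp h.1 ⟨h0, h1⟩
  · have h0 := h 0 ⟨le_rfl, zero_le_one⟩
    rwa [sub_zero, weightedGeomMean_zero hsp, weightedGeomMean_one hsp] at h0
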